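/- \textbf{Corollary (existence of complete solutions).} Let $\mathcal{X} \subset \mathbb{R}^n$, let $f : \mathcal{X} \to \mathbb{R}^n$ be a vector field, and let $g$ be a metric on $\mathcal{X}$, i.e.\ a map assigning to every $x \in \mathcal{X}$ an inner product $\langle \cdot,\cdot\rangle_{g(x)}$ on $\mathbb{R}^n$ (no continuity is required); write $\|v\|_{g(x)} := \sqrt{\langle v,v\rangle_{g(x)}}$. \emph{Definitions.} The tangent cone $T_x\mathcal{X}$ is the set of all limits of $(x_k-x)/\delta_k$ with $x_k \in \mathcal{X}$, $x_k \to x$ and $\delta_k \to 0^+$. The projected vector field is $\Pi_{\mathcal{X}}^g f(x) := \arg\min_{v \in T_x\mathcal{X}} \|v - f(x)\|_{g(x)}^2$ (a set). For a set-valued map $F$ on $\mathcal{X}$, $\limsup_{y \to x} F(y)$ is the set of all limits of sequences $v_k \in F(y_k)$ with $y_k \in \mathcal{X}$, $y_k \to x$, and the Krasovskii regularization $K[F](x)$ is the closed convex hull of $\limsup_{y\to x} F(y)$. For $0 < T \le \infty$, a Krasovskii solution on $[0,T)$ of $$\dot x \in \Pi_{\mathcal{X}}^g f(x), \qquad x(0)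 = x_0, \tag{1}$$ is a function $x : [0,T) \to \mathcal{X}$ with $x(0) = x_0$ that is absolutely continuous on every compact subinterval of $[0,T)$ and satisfies $\dot x(t) \in K[\Pi_{\mathcal{X}}^g f](x(t))$ for almost every $t \in [0,T)$. The metric $g$ is weakly bounded if there are $\ell, L > 0$ with $\ell \le \kappa_{g(x)} \le L$ for all $x \in \mathcal{X}$, where $\kappa_{g(x)} := \max_{\|v\|=1}\|v\|_{g(x)} \,/\, \min_{\|v\|=1}\|v\|_{g(x)}$. Suppose that at least one of the following holds: \begin{enumerate} \item[(i)] $\mathcal{X}$ is closed, $f$ is bounded, and $g$ is weakly bounded; \item[(ii)] $\mathcal{X}$ is compact, and $f$ and $g$ are continuous (on $\mathcal{X}$); \item[(iii)] $\mathcal{X}$ is closed, $f$ is globally Lipschitz (on $\mathcal{X}$), and $g$ is weakly bounded. \end{enumerate} Then for every $x_0 \in \mathcal{X}$, every Krasovskii solution $x : [0,T) \to \mathcal{X}$ of (1) can be extended to $[0,\infty)$: there is a Krasovskii solution $y : [0,\infty) \to \mathcal{X}$ of (1) with $y(t) = x(t)$ for all $t \in [0,T)$. -/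

import Mathlib

open Set Filter Topology MeasureTheory

noncomputable section

namespace ProjDyn

/-- `ℝⁿ` with its Euclidean inner product and norm. -/
abbrev Euc (n : ℕ) : Type := EuclideanSpace ℝ (Fin n)

/-- The space of bilinear forms on `ℝⁿ` (every bilinear form is continuous), a finite-dimensional
normed space. -/
abbrev BilinForms (n : ℕ) : Type := Euc n →L[ℝ] Euc n →L[ℝ] ℝ

variable {n : ℕ}

/-- `b` is an inner product: a symmetric positive definite bilinear form. -/
structure IsInnerProduct (b : BilinForms n) : Prop where
  symm : ∀ u v, b u v = b v u
  pos : ∀ v, v ≠ 0 → 0 < b v v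

/-- `g` is a (possibly discontinuous) Riemannian metric on `X`. Only the values of `g` at points of
`X` matter. -/
def IsMetricOn (X : Set (Euc n)) (g : Euc n → BilinForms n) : Prop :=
  ∀ x ∈ X, IsInnerProduct (g x)

/-- The norm `‖v‖_b = √(b(v, v))` induced by an inner product `b`. -/
def formNorm (b : BilinForms n) (v : Euc n) : ℝ := √(b v v)

/-- `λ^max_b = max {‖v‖_b | ‖v‖ = 1}`. -/
def lambdaMax (b : BilinForms n) : ℝ := sSup (formNorm b '' Metric.sphere 0 1)

/-- `λ^min_b = min {‖v‖_b | ‖v‖ = 1}`. -/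
def lambdaMin (b : BilinForms n) : ℝ := sInf (formNorm b '' Metric.sphere 0 1)

/-- The condition number `κ_b = λ^max_b / λ^min_b`. -/
def condNumber (b : BilinForms n) : ℝ := lambdaMax b / lambdaMin b

/-- The metric `g` is weakly bounded on `X`: its condition number is bounded above, and bounded
below away from zero, uniformly on `X`. -/
def WeaklyBoundedOn (X : Set (Euc n)) (g : Euc n → BilinForms n) : Prop :=
  ∃ l L : ℝ, 0 < l ∧ 0 < L ∧ ∀ x ∈ X, l ≤ condNumber (g x) ∧ condNumber (g x) ≤ L

/-- The vector field `f` is bounded on `X`. -/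
def BoundedOn (X : Set (Euc n)) (f : Euc n → Euc n) : Prop :=
  ∃ L : ℝ, 0 < L ∧ ∀ x ∈ X, ‖f x‖ ≤ L

/-- The (Bouligand) tangent cone of `X` at `x`: all limits of `(x_k - x) / δ_k` with `x_k ∈ X`,
`x_k → x` and `δ_k → 0⁺`. -/
def tangentCone (X : Set (Euc n)) (x : Euc n) : Set (Euc n) :=
  {v | ∃ (p : ℕ → Euc n) (δ : ℕ → ℝ), (∀ k, p k ∈ X) ∧ Tendsto p atTop (𝓝 x) ∧
    (∀ k, 0 < δ k) ∧ Tendsto δ atTop (𝓝 0) ∧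
    Tendsto (fun k => (δ k)⁻¹ • (p k - x)) atTop (𝓝 v)}

/-- The projected vector field: `Π_X^g f (x)` is the set of minimizers of `‖v - f(x)‖²_{g(x)}`
over `v` in the tangent cone of `X` at `x`. -/
def projField (X : Set (Euc n)) (g : Euc n → BilinForms n) (f : Euc n → Euc n)
    (x : Euc n) : Set (Euc n) :=
  {v | v ∈ tangentCone X x ∧
    ∀ w ∈ tangentCone X x, formNorm (g x) (v - f x) ^ 2 ≤ formNorm (g x) (w - f x) ^ 2}

/-- The outer limit of a sequence of sets `C_k`: all limits of sequences `u_j ∈ C_{φ(j)}` along a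
subsequence `φ`. -/
def seqOuterLimit (C : ℕ → Set (Euc n)) : Set (Euc n) :=
  {v | ∃ (φ : ℕ → ℕ) (u : ℕ → Euc n), StrictMono φ ∧ (∀ j, u j ∈ C (φ j)) ∧
    Tendsto u atTop (𝓝 v)}

/-- The outer limit `lim sup_{y → x} F(y)` of a set-valued map `F` on `X`: the union, over all
sequences `p` in `X` converging to `x`, of the outer limits of `F (p k)`. -/
def outerLimit (X : Set (Euc n)) (F : Euc n → Set (Euc n)) (x : Euc n) : Set (Euc n) :=
  {v | ∃ p : ℕ → Euc n, (∀ k, p k ∈ X) ∧ Tendsto p atTop (𝓝 x) ∧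
    v ∈ seqOuterLimit (fun k => F (p k))}

/-- The Krasovskii regularization `K[F]` of a set-valued map `F` on `X`: the closed convex hull of
its outer limit. -/
def krasovskii (X : Set (Euc n)) (F : Euc n → Set (Euc n)) (x : Euc n) : Set (Euc n) :=
  closedConvexHull ℝ (outerLimit X F x)

/-- `x` is a Krasovskii solution, defined on `[0, T)` with `0 < T ≤ ∞`, of the initial value problem
`ẋ ∈ F(x)`, `x(0) = x₀`, for the set-valued map `F` on `X`: it stays in `X`, it is absolutely
continuous on every `[0, t]` with `t < T`, and `ẋ(t)` exists and lies in `K[F](x(t))` for almost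
every `t`. Only the values of `x` on `[0, T)` matter. -/
structure IsKrasovskiiSolution (X : Set (Euc n)) (F : Euc n → Set (Euc n)) (x₀ : Euc n)
    (T : EReal) (x : ℝ → Euc n) : Prop where
  pos : 0 < T
  init : x 0 = x₀
  mem : ∀ t : ℝ, 0 ≤ t → (t : EReal) < T → x t ∈ X
  absCont : ∀ t : ℝ, 0 ≤ t → (t : EReal) < T → AbsolutelyContinuousOnInterval x 0 t
  deriv_mem : ∀ᵐ t : ℝ, 0 ≤ t → (t : EReal) < T → ∃ v ∈ krasovskii X F (x t), HasDerivAt x v t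

end ProjDyn

end

namespace ProjDyn

variable {n : ℕ}

/-! ### Tangent cone: a sequence-free description, and closedness. -/

section TangentCone

/-! Each of the three hypotheses makes `X` closed and gives `F = projField X g f` nonempty values,
contained in the tangent cone and of linear growth; nothing else about `f` and `g` is used
afterwards. Growth holds because `0` is a tangent vector: a minimizer `v` satisfies `‖v - f‖_g ≤
‖f‖_g`, hence `‖v‖_g ≤ 2‖f‖_g`, and a uniform comparison of `g` with the Euclidean norm finishes
(`exists_linearGrowthOn_projField`).

The Krasovskii regularization inherits the growth bound, so by Grönwall a solution on `[0, T)` with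
`T` finite is bounded, hence Lipschitz, and converges at `T` to some `p ∈ X`. It remains to restart
at `p` and concatenate (`IsKrasovskiiSolution.exists_extension`).

The restart is a viability theorem, `exists_complete_solution`. Tangency allows Euler steps whose
nodes stay in `X`; on bounded sets the step sizes are bounded below by compactness, and linear
growth keeps the nodes bounded in finite time, so the scheme passes every time. In a limit of finer
schemes, short-time slopes are averages of values of `F` at nearby points, and derivatives therefore
lie in the regularization. -/

theorem mem_tangentCone_iff {X : Set (Euc n)} {x v : Euc n} :
    v ∈ tangentCone X x ↔
      ∀ ε > 0, ∃ δ > 0, δ < ε ∧ ∃ p ∈ X, ‖p - x - δ • v‖ ≤ ε * δ := by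
  constructor
  · rintro ⟨p, δ, hp, -, hδ, hδ0, hlim⟩ ε hε
    have h1 : ∀ᶠ k in atTop, δ k < ε := hδ0.eventually (gt_mem_nhds hε)
    have h2 : ∀ᶠ k in atTop, dist ((δ k)⁻¹ • (p k - x)) v < ε :=
      hlim.eventually (Metric.ball_mem_nhds v hε)
    obtain ⟨k, hk1, hk2⟩ := (h1.and h2).exists
    refine ⟨δ k, hδ k, hk1, p k, hp k, ?_⟩
    have hk := hδ k
    have : p k - x - δ k • v = δ k • ((δ k)⁻¹ • (p k - x) - v) := by
      rw [smul_sub, smul_smul, mul_inv_cancel₀ hk.ne', one_smul]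
    rw [this, norm_smul, Real.norm_of_nonneg hk.le, mul_comm, ← dist_eq_norm]
    gcongr
  · intro h
    have hpos : ∀ k : ℕ, (0 : ℝ) < 1 / ((k : ℝ) + 1) := fun k => Nat.one_div_pos_of_nat
    choose δ hδ hδk p hp hpk using fun k : ℕ => h _ (hpos k)
    have hδ0 : Tendsto δ atTop (𝓝 0) :=
      squeeze_zero (fun k => (hδ k).le) (fun k => (hδk k).le) tendsto_one_div_add_atTop_nhds_zero_nat
    have hlim : Tendsto (fun k => (δ k)⁻¹ • (p k - x)) atTop (𝓝 v) := by
      rw [tendsto_iff_norm_sub_tendsto_zero]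
      refine squeeze_zero (fun k => norm_nonneg _) (fun k => ?_)
        tendsto_one_div_add_atTop_nhds_zero_nat
      have hk := hδ k
      have : (δ k)⁻¹ • (p k - x) - v = (δ k)⁻¹ • (p k - x - δ k • v) := by
        rw [smul_sub _ (p k - x), smul_smul, inv_mul_cancel₀ hk.ne', one_smul]
      rw [this, norm_smul, Real.norm_of_nonneg (inv_pos.2 hk).le, inv_mul_le_iff₀ hk, mul_comm]
      exact hpk k
    -- `p k → x` is automatic: `p k - x` is `δ k → 0` times a convergent quotient.
    refine ⟨p, δ, hp, ?_, hδ, hδ0, hlim⟩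
    have h2 := (hδ0.smul hlim).add_const x
    simp only [zero_smul, zero_add] at h2
    refine h2.congr fun k => ?_
    rw [smul_smul, mul_inv_cancel₀ (hδ k).ne', one_smul, sub_add_cancel]

theorem zero_mem_tangentCone {X : Set (Euc n)} {x : Euc n} (hx : x ∈ X) :
    (0 : Euc n) ∈ tangentCone X x := by
  rw [mem_tangentCone_iff]
  intro ε hε
  refine ⟨ε / 2, half_pos hε, half_lt_self hε, x, hx, ?_⟩
  simp only [sub_self, smul_zero, norm_zero]
  positivity

theorem isClosed_tangentCone (X : Set (Euc n)) (x : Euc n) : IsClosed (tangentCone X x) := by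
  refine isClosed_of_closure_subset fun v hv => mem_tangentCone_iff.2 fun ε hε => ?_
  obtain ⟨u, hu, huv⟩ := Metric.mem_closure_iff.1 hv (ε / 2) (half_pos hε)
  obtain ⟨δ, hδ, hδε, p, hp, hpu⟩ := mem_tangentCone_iff.1 hu (ε / 2) (half_pos hε)
  refine ⟨δ, hδ, by linarith, p, hp, ?_⟩
  have h1 : p - x - δ • v = (p - x - δ • u) + δ • (u - v) := by rw [smul_sub]; abel
  have h2 : ‖δ • (u - v)‖ ≤ δ * (ε / 2) := by
    rw [norm_smul, Real.norm_of_nonneg hδ.le, ← dist_eq_norm, dist_comm]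
    gcongr
  rw [h1]
  refine (norm_add_le _ _).trans ?_
  linarith

end TangentCone

/-! ### Uniform comparison of the metric with the Euclidean norm. -/

section Metric

theorem IsInnerProduct.apply_self_nonneg {b : BilinForms n} (hb : IsInnerProduct b) (v : Euc n) :
    0 ≤ b v v := by
  rcases eq_or_ne v 0 with rfl | hv
  · simp
  · exact (hb.pos v hv).le

theorem formNorm_sq {b : BilinForms n} (hb : IsInnerProduct b) (v : Euc n) :
    formNorm b v ^ 2 = b v v :=
  Real.sq_sqrt (hb.apply_self_nonneg v)

theorem formNorm_smul (b : BilinForms n) (c : ℝ) (v : Euc n) :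
    formNorm b (c • v) = |c| * formNorm b v := by
  simp only [formNorm, map_smul, smul_apply, smul_eq_mul]
  rw [← mul_assoc, Real.sqrt_mul (mul_self_nonneg c), Real.sqrt_mul_self_eq_abs]

theorem continuous_formNorm (b : BilinForms n) : Continuous (formNorm b) := by
  unfold formNorm
  fun_prop

/-- A continuous family of inner products over a compact set is uniformly elliptic. -/
theorem exists_ellipticity_const {X : Set (Euc n)} {g : Euc n → BilinForms n} (hX : IsCompact X)
    (hgc : ContinuousOn g X) (hg : IsMetricOn X g) :
    ∃ m > 0, ∀ x ∈ X, ∀ u, m * ‖u‖ ^ 2 ≤ g x u u := by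
  have hscale : ∀ x (u : Euc n), u ≠ 0 →
      g x u u = g x (‖u‖⁻¹ • u) (‖u‖⁻¹ • u) * ‖u‖ ^ 2 := fun x u hu => by
    have : ‖u‖ ≠ 0 := norm_ne_zero_iff.2 hu
    simp only [map_smul, smul_apply, smul_eq_mul]
    field_simp
  have hsph : ∀ u : Euc n, u ≠ 0 → ‖u‖⁻¹ • u ∈ Metric.sphere (0 : Euc n) 1 := fun u hu => by
    simp [norm_smul, norm_ne_zero_iff.2 hu]
  -- The product is empty when `X` is empty or `n = 0`; there is then no minimum to take.
  rcases (X ×ˢ Metric.sphere (0 : Euc n) 1).eq_empty_or_nonempty with hemp | hne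
  · refine ⟨1, one_pos, fun x hx u => ?_⟩
    have hu : u = 0 := by
      by_contra hu
      exact (hemp ▸ (⟨hx, hsph u hu⟩ : (x, ‖u‖⁻¹ • u) ∈ X ×ˢ Metric.sphere (0 : Euc n) 1) :
        (x, ‖u‖⁻¹ • u) ∈ (∅ : Set (Euc n × Euc n)))
    simp [hu]
  · have hc : ContinuousOn (fun q : Euc n × Euc n => g q.1 q.2 q.2)
        (X ×ˢ Metric.sphere (0 : Euc n) 1) := by
      have h1 : ContinuousOn (fun q : Euc n × Euc n => g q.1) (X ×ˢ Metric.sphere (0 : Euc n) 1) :=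
        hgc.comp continuousOn_fst fun q hq => hq.1
      exact (h1.clm_apply continuousOn_snd).clm_apply continuousOn_snd
    obtain ⟨⟨x₁, u₁⟩, ⟨hx₁, hu₁⟩, hmin⟩ := (hX.prod (isCompact_sphere _ _)).exists_isMinOn hne hc
    have hu₁0 : u₁ ≠ 0 := by
      rintro rfl
      simp at hu₁
    refine ⟨g x₁ u₁ u₁, (hg x₁ hx₁).pos u₁ hu₁0, fun x hx u => ?_⟩
    rcases eq_or_ne u 0 with rfl | hu
    · simp
    · rw [hscale x u hu]
      gcongr
      exact isMinOn_iff.1 hmin (x, ‖u‖⁻¹ • u) ⟨hx, hsph u hu⟩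

/-- The Euclidean norm is controlled by the metric up to a constant factor, uniformly on `X`. -/
def UniformlyComparableOn (X : Set (Euc n)) (g : Euc n → BilinForms n) : Prop :=
  ∃ K ≥ 0, ∀ x ∈ X, ∀ u v, g x u u ≤ g x v v → ‖u‖ ≤ K * ‖v‖

theorem uniformlyComparableOn_of_isCompact {X : Set (Euc n)} {g : Euc n → BilinForms n}
    (hX : IsCompact X) (hgc : ContinuousOn g X) (hg : IsMetricOn X g) :
    UniformlyComparableOn X g := by
  obtain ⟨m, hm, hell⟩ := exists_ellipticity_const hX hgc hg
  obtain ⟨B, hB⟩ := hX.exists_bound_of_continuousOn (E := BilinForms n) (f := g) hgc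
  refine ⟨√(B / m), Real.sqrt_nonneg _, fun x hx u v huv => ?_⟩
  have hB0 : 0 ≤ B := (norm_nonneg _).trans (hB x hx)
  have h1 : g x v v ≤ B * ‖v‖ ^ 2 := by
    calc g x v v ≤ ‖g x v v‖ := le_abs_self _
      _ ≤ ‖g x‖ * ‖v‖ * ‖v‖ := (g x).le_opNorm₂ v v
      _ ≤ B * ‖v‖ * ‖v‖ := by gcongr; exact hB x hx
      _ = B * ‖v‖ ^ 2 := by ring
  have h2 : ‖u‖ ^ 2 ≤ B / m * ‖v‖ ^ 2 := by
    rw [div_mul_eq_mul_div, le_div_iff₀ hm]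
    linarith [hell x hx u]
  refine le_of_sq_le_sq ?_ (by positivity)
  rwa [mul_pow, Real.sq_sqrt (by positivity)]

theorem formNorm_le_lambdaMax_mul (b : BilinForms n) (v : Euc n) :
    formNorm b v ≤ lambdaMax b * ‖v‖ := by
  rcases eq_or_ne v 0 with rfl | hv
  · simp [formNorm]
  have hv' : 0 < ‖v‖ := norm_pos_iff.2 hv
  have hbdd : BddAbove (formNorm b '' Metric.sphere 0 1) :=
    ((isCompact_sphere _ _).image (continuous_formNorm b)).bddAbove
  have h1 : formNorm b (‖v‖⁻¹ • v) ≤ lambdaMax b :=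
    le_csSup hbdd ⟨_, by simp [norm_smul, hv'.ne'], rfl⟩
  rwa [formNorm_smul, abs_of_pos (inv_pos.2 hv'), inv_mul_le_iff₀ hv', mul_comm] at h1

theorem lambdaMin_mul_le_formNorm (b : BilinForms n) (v : Euc n) :
    lambdaMin b * ‖v‖ ≤ formNorm b v := by
  rcases eq_or_ne v 0 with rfl | hv
  · simp [formNorm]
  have hv' : 0 < ‖v‖ := norm_pos_iff.2 hv
  have hbdd : BddBelow (formNorm b '' Metric.sphere 0 1) :=
    ((isCompact_sphere _ _).image (continuous_formNorm b)).bddBelow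
  have h1 : lambdaMin b ≤ formNorm b (‖v‖⁻¹ • v) :=
    csInf_le hbdd ⟨_, by simp [norm_smul, hv'.ne'], rfl⟩
  rwa [formNorm_smul, abs_of_pos (inv_pos.2 hv'), inv_mul_eq_div, le_div_iff₀ hv'] at h1

/-- The vector `u` rules out `n = 0`, where the unit sphere is empty and the infimum takes the
default value `0`. -/
theorem lambdaMin_pos {b : BilinForms n} (hb : IsInnerProduct b) {u : Euc n} (hu : u ≠ 0) :
    0 < lambdaMin b := by
  have hne : (Metric.sphere (0 : Euc n) 1).Nonempty :=
    ⟨‖u‖⁻¹ • u, by simp [norm_smul, norm_ne_zero_iff.2 hu]⟩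
  obtain ⟨w, hw, hmin⟩ := ((isCompact_sphere (0 : Euc n) 1).image
    (continuous_formNorm b)).sInf_mem (hne.image _)
  have hw0 : w ≠ 0 := by
    rintro rfl
    simp at hw
  rw [lambdaMin, ← hmin]
  exact Real.sqrt_pos.2 (hb.pos w hw0)

theorem WeaklyBoundedOn.uniformlyComparableOn {X : Set (Euc n)} {g : Euc n → BilinForms n}
    (h : WeaklyBoundedOn X g) (hg : IsMetricOn X g) : UniformlyComparableOn X g := by
  obtain ⟨_, L, -, hL, hκ⟩ := h
  refine ⟨L, hL.le, fun x hx u v huv => ?_⟩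
  rcases eq_or_ne u 0 with rfl | hu
  · rw [norm_zero]; positivity
  have hpos := lambdaMin_pos (hg x hx) hu
  have h1 : lambdaMin (g x) * ‖u‖ ≤ lambdaMax (g x) * ‖v‖ :=
    (lambdaMin_mul_le_formNorm _ _).trans
      ((Real.sqrt_le_sqrt huv).trans (formNorm_le_lambdaMax_mul _ _))
  calc ‖u‖ ≤ condNumber (g x) * ‖v‖ := by
        rw [condNumber, div_mul_eq_mul_div, le_div_iff₀ hpos]
        linarith
    _ ≤ L * ‖v‖ := by gcongr; exact (hκ x hx).2

end Metric

/-! ### The projected field: existence of minimizers and linear growth. -/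

section ProjField

variable {X : Set (Euc n)} {g : Euc n → BilinForms n} {f : Euc n → Euc n}

/-- A coercive continuous function attains its minimum on a closed set; the cone need not be convex.
-/
theorem projField_nonempty (hg : IsMetricOn X g) {x : Euc n} (hx : x ∈ X) :
    (projField X g f x).Nonempty := by
  obtain ⟨m, hm, hell⟩ := exists_ellipticity_const (isCompact_singleton (x := x))
    (continuousOn_singleton g x) fun y hy => hy ▸ hg x hx
  have hc : Continuous fun v : Euc n => g x (v - f x) (v - f x) := by fun_prop
  have hcoer : Tendsto (fun v : Euc n => g x (v - f x) (v - f x)) (cocompact (Euc n)) atTop := by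
    have h1 : Tendsto (fun v : Euc n => ‖v - f x‖) (cocompact (Euc n)) atTop :=
      tendsto_norm_cocompact_atTop.comp
        (Homeomorph.subRight (f x)).isClosedEmbedding.tendsto_cocompact
    have h2 : Tendsto (fun v : Euc n => m * ‖v - f x‖ ^ 2) (cocompact (Euc n)) atTop :=
      ((tendsto_pow_atTop two_ne_zero).comp h1).const_mul_atTop hm
    exact tendsto_atTop_mono (fun v => hell x rfl _) h2
  obtain ⟨v, hv, hmin⟩ := hc.continuousOn.exists_isMinOn' (isClosed_tangentCone X x)
    (zero_mem_tangentCone hx) ((hcoer.eventually_ge_atTop _).filter_mono inf_le_left)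
  refine ⟨v, hv, fun w hw => ?_⟩
  rw [formNorm_sq (hg x hx), formNorm_sq (hg x hx)]
  exact isMinOn_iff.1 hmin w hw

theorem apply_self_projField_le (hg : IsMetricOn X g) {x v : Euc n} (hx : x ∈ X)
    (hv : v ∈ projField X g f x) : g x v v ≤ g x ((2 : ℝ) • f x) ((2 : ℝ) • f x) := by
  have h1 := hv.2 0 (zero_mem_tangentCone hx)
  rw [formNorm_sq (hg x hx), formNorm_sq (hg x hx)] at h1
  -- Replaces the triangle inequality: minimality against `0` reads `g(v,v) ≤ 2 g(v,f)`, and `g(v -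
  -- 2f, v - 2f) ≥ 0` bounds `4 g(v,f)` by `g(v,v) + 4 g(f,f)`.
  have h2 := (hg x hx).apply_self_nonneg (v - (2 : ℝ) • f x)
  simp only [map_sub, map_smul, sub_apply, smul_apply,
    smul_eq_mul, zero_sub, map_neg, neg_apply] at h1 h2 ⊢
  have h3 := (hg x hx).symm v (f x)
  linarith

/-- The set-valued map `F` has at most linear growth on `X`. -/
def LinearGrowthOn (X : Set (Euc n)) (F : Euc n → Set (Euc n)) (C : ℝ) : Prop :=
  ∀ x ∈ X, ∀ v ∈ F x, ‖v‖ ≤ C * (1 + ‖x‖)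

theorem exists_linearGrowthOn_projField (hg : IsMetricOn X g) (hcomp : UniformlyComparableOn X g)
    {A : ℝ} (hA : 0 ≤ A) (hf : ∀ x ∈ X, ‖f x‖ ≤ A * (1 + ‖x‖)) :
    ∃ C ≥ 0, LinearGrowthOn X (projField X g f) C := by
  obtain ⟨K, hK, hKx⟩ := hcomp
  refine ⟨K * (2 * A), by positivity, fun x hx v hv => ?_⟩
  have h1 := hKx x hx _ _ (apply_self_projField_le hg hx hv)
  rw [norm_smul, Real.norm_ofNat] at h1
  calc ‖v‖ ≤ K * (2 * ‖f x‖) := h1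
    _ ≤ K * (2 * (A * (1 + ‖x‖))) := by gcongr; exact hf x hx
    _ = K * (2 * A) * (1 + ‖x‖) := by ring

theorem exists_linear_growth_of_lipschitzOnWith {L : NNReal} (hf : LipschitzOnWith L f X) :
    ∃ A ≥ 0, ∀ x ∈ X, ‖f x‖ ≤ A * (1 + ‖x‖) := by
  rcases X.eq_empty_or_nonempty with rfl | ⟨p, hp⟩
  · exact ⟨0, le_rfl, by simp⟩
  refine ⟨‖f p‖ + L * (1 + ‖p‖), by positivity, fun x hx => ?_⟩
  have h1 := hf.dist_le_mul x hx p hp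
  rw [dist_eq_norm, dist_eq_norm] at h1
  have h2 : ‖f x‖ ≤ ‖f p‖ + L * (‖x‖ + ‖p‖) :=
    calc ‖f x‖ ≤ ‖f p‖ + ‖f x - f p‖ := norm_le_norm_add_norm_sub' _ _
      _ ≤ ‖f p‖ + L * (‖x‖ + ‖p‖) := by
        gcongr
        exact h1.trans (by gcongr; exact norm_sub_le _ _)
  have h3 : 0 ≤ ‖f p‖ * ‖x‖ := by positivity
  have h4 : 0 ≤ (L : ℝ) * (1 + ‖p‖ * ‖x‖) := by positivity
  nlinarith

theorem exists_linear_growth_of_bound {A : ℝ} (hf : ∀ x ∈ X, ‖f x‖ ≤ A) :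
    ∃ A ≥ 0, ∀ x ∈ X, ‖f x‖ ≤ A * (1 + ‖x‖) := by
  refine ⟨max A 0, le_max_right _ _, fun x hx => ?_⟩
  calc ‖f x‖ ≤ max A 0 * 1 := by rw [mul_one]; exact (hf x hx).trans (le_max_left _ _)
    _ ≤ max A 0 * (1 + ‖x‖) := by gcongr; linarith [norm_nonneg x]

end ProjField

/-! ### Euler schemes in a closed set and the step curves they define. -/

section Euler

variable {X : Set (Euc n)} {F : Euc n → Set (Euc n)} {x₀ : Euc n} {C ε : ℝ}

/-- All vectors within `ε` of a value of `F` at a point of `X` within `ε` of `x`. -/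
def thickenedField (X : Set (Euc n)) (F : Euc n → Set (Euc n)) (ε : ℝ) (x : Euc n) :
    Set (Euc n) :=
  {w | ∃ y ∈ X, dist y x ≤ ε ∧ ∃ v ∈ F y, dist w v ≤ ε}

theorem LinearGrowthOn.norm_le_of_mem_thickenedField (hC : 0 ≤ C) (hF : LinearGrowthOn X F C)
    (hε : ε ≤ 1) {x w : Euc n} (hw : w ∈ thickenedField X F ε x) :
    ‖w‖ ≤ (2 * C + 1) * (1 + ‖x‖) := by
  obtain ⟨y, hy, hyx, v, hv, hwv⟩ := hw
  have h1 : ‖y‖ ≤ ‖x‖ + 1 := by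
    rw [dist_eq_norm] at hyx
    linarith [norm_le_norm_add_norm_sub' y x]
  have h2 : ‖w‖ ≤ ‖v‖ + 1 := by
    rw [dist_eq_norm] at hwv
    linarith [norm_le_norm_add_norm_sub' w v]
  have h3 : ‖v‖ ≤ C * (2 + ‖x‖) := (hF y hy v hv).trans (mul_le_mul_of_nonneg_left (by linarith) hC)
  nlinarith [norm_nonneg x, mul_nonneg hC (norm_nonneg x)]

/-- On bounded sets, an `ε`-approximate Euler step staying in `X` is possible with a step size
bounded below. -/
theorem exists_euler_step (hX : IsClosed X) (hne : ∀ x ∈ X, (F x).Nonempty)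
    (hT : ∀ x ∈ X, F x ⊆ tangentCone X x) (hε : 0 < ε) (R : ℝ) :
    ∃ h > 0, ∀ x ∈ X, ‖x‖ ≤ R →
      ∃ δ w, h ≤ δ ∧ δ ≤ ε ∧ w ∈ thickenedField X F ε x ∧ x + δ • w ∈ X := by
  have hK : IsCompact (X ∩ Metric.closedBall 0 R) := (isCompact_closedBall _ _).inter_left hX
  suffices H : ∃ h > 0, ∀ x ∈ X ∩ Metric.closedBall 0 R,
      ∃ δ w, h ≤ δ ∧ δ ≤ ε ∧ w ∈ thickenedField X F ε x ∧ x + δ • w ∈ X by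
    obtain ⟨h, hh, H⟩ := H
    exact ⟨h, hh, fun x hx hxR => H x ⟨hx, mem_closedBall_zero_iff.2 hxR⟩⟩
  refine hK.induction_on (p := fun S => ∃ h > 0, ∀ x ∈ S,
      ∃ δ w, h ≤ δ ∧ δ ≤ ε ∧ w ∈ thickenedField X F ε x ∧ x + δ • w ∈ X) ?_ ?_ ?_ ?_
  · exact ⟨1, one_pos, by simp⟩
  · rintro S S' hSS' ⟨h, hh, H⟩
    exact ⟨h, hh, fun x hx => H x (hSS' hx)⟩
  · rintro S S' ⟨a, ha, H⟩ ⟨b, hb, H'⟩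
    refine ⟨min a b, lt_min ha hb, fun x hx => ?_⟩
    rcases hx with hx | hx
    · obtain ⟨δ, w, hδ, hr⟩ := H x hx
      exact ⟨δ, w, (min_le_left _ _).trans hδ, hr⟩
    · obtain ⟨δ, w, hδ, hr⟩ := H' x hx
      exact ⟨δ, w, (min_le_right _ _).trans hδ, hr⟩
  · intro y hy
    obtain ⟨v, hv⟩ := hne y hy.1
    obtain ⟨δ, hδ, hδε, p, hp, hpv⟩ :=
      mem_tangentCone_iff.1 (hT y hy.1 hv) (ε / 2) (half_pos hε)
    -- One target point `p` serves every `x` near `y`: moving the base point changes the slope by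
    -- `‖y - x‖ / δ`, less than `ε / 2` on this ball.
    refine ⟨_, inter_mem self_mem_nhdsWithin (mem_nhdsWithin_of_mem_nhds (Metric.ball_mem_nhds y
      (lt_min hε (by positivity : 0 < ε / 2 * δ)))), δ, hδ, ?_⟩
    rintro x ⟨-, hx⟩
    rw [Metric.mem_ball, lt_min_iff, dist_comm] at hx
    refine ⟨δ, δ⁻¹ • (p - x), le_rfl, by linarith, ⟨y, hy.1, hx.1.le, v, hv, ?_⟩, ?_⟩
    · have : δ⁻¹ • (p - x) - v = δ⁻¹ • ((p - y - δ • v) + (y - x)) := by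
        rw [show p - y - δ • v + (y - x) = p - x - δ • v by abel, smul_sub _ (p - x), smul_smul,
          inv_mul_cancel₀ hδ.ne', one_smul]
      rw [dist_eq_norm, this, norm_smul, Real.norm_of_nonneg (inv_pos.2 hδ).le,
        inv_mul_le_iff₀ hδ]
      refine (norm_add_le _ _).trans ?_
      rw [← dist_eq_norm y x]
      linarith [hx.2]
    · rwa [smul_smul, mul_inv_cancel₀ hδ.ne', one_smul, add_sub_cancel]

/-- The nodes `y`, step sizes `δ` and slopes `w` of an Euler scheme with accuracy `ε` whose step
sizes do not vanish as long as the nodes stay bounded. -/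
structure IsEulerScheme (X : Set (Euc n)) (F : Euc n → Set (Euc n)) (x₀ : Euc n) (ε : ℝ)
    (y : ℕ → Euc n) (δ : ℕ → ℝ) (w : ℕ → Euc n) : Prop where
  init : y 0 = x₀
  mem : ∀ k, y k ∈ X
  step_pos : ∀ k, 0 < δ k
  step_le : ∀ k, δ k ≤ ε
  slope_mem : ∀ k, w k ∈ thickenedField X F ε (y k)
  succ_eq : ∀ k, y (k + 1) = y k + δ k • w k
  step_ge : ∀ M : ℝ, (∀ k, ‖y k‖ ≤ M) → ∃ h > 0, ∀ k, h ≤ δ k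

theorem exists_isEulerScheme (hX : IsClosed X) (hne : ∀ x ∈ X, (F x).Nonempty)
    (hT : ∀ x ∈ X, F x ⊆ tangentCone X x) (hε : 0 < ε) (hx₀ : x₀ ∈ X) :
    ∃ y δ w, IsEulerScheme X F x₀ ε y δ w := by
  choose h hh H using fun N : ℕ => exists_euler_step hX hne hT hε (N : ℝ)
  -- The step at `x` uses the bound for radius `⌈‖x‖⌉₊`, so bounded nodes involve only finitely many
  -- of the constants `h N`.
  choose! δ w hδ hδε hw hmem using fun (x : Euc n) (hx : x ∈ X) =>
    H ⌈‖x‖⌉₊ x hx (Nat.le_ceil _)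
  let y : ℕ → Euc n := fun k => Nat.rec x₀ (fun _ x => x + δ x • w x) k
  have hy : ∀ k, y k ∈ X := fun k => by
    induction k with
    | zero => exact hx₀
    | succ k ih => exact hmem _ ih
  refine ⟨y, fun k => δ (y k), fun k => w (y k), rfl, hy, fun k => (hh _).trans_le (hδ _ (hy k)),
    fun k => hδε _ (hy k), fun k => hw _ (hy k), fun k => rfl, fun M hM => ?_⟩
  obtain ⟨N, -, hN⟩ := (Finset.range (⌈M⌉₊ + 1)).exists_min_image h ⟨0, by simp⟩
  refine ⟨h N, hh N, fun k => (hN ⌈‖y k‖⌉₊ ?_).trans (hδ _ (hy k))⟩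
  rw [Finset.mem_range, Nat.lt_succ_iff]
  exact Nat.ceil_mono (hM k)

namespace IsEulerScheme

variable {y : ℕ → Euc n} {δ : ℕ → ℝ} {w : ℕ → Euc n}

theorem monotone_time (h : IsEulerScheme X F x₀ ε y δ w) :
    Monotone fun k => ∑ i ∈ Finset.range k, δ i :=
  monotone_nat_of_le_succ fun k => by
    rw [Finset.sum_range_succ]
    linarith [h.step_pos k]

/-- Discrete Grönwall: each step multiplies `1 + ‖y k‖` by at most `1 + (2C + 1) δ k ≤ exp((2C + 1)
δ k)`. -/
theorem norm_le (h : IsEulerScheme X F x₀ ε y δ w) (hC : 0 ≤ C) (hF : LinearGrowthOn X F C)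
    (hε : ε ≤ 1) (k : ℕ) :
    1 + ‖y k‖ ≤ (1 + ‖x₀‖) * Real.exp ((2 * C + 1) * ∑ i ∈ Finset.range k, δ i) := by
  induction k with
  | zero => simp [h.init]
  | succ k ih =>
    have h1 := hF.norm_le_of_mem_thickenedField hC hε (h.slope_mem k)
    have hδ := h.step_pos k
    have h2 : ‖y (k + 1)‖ ≤ ‖y k‖ + δ k * ((2 * C + 1) * (1 + ‖y k‖)) := by
      rw [h.succ_eq]
      refine (norm_add_le _ _).trans ?_
      rw [norm_smul, Real.norm_of_nonneg hδ.le]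
      gcongr
    rw [Finset.sum_range_succ, mul_add, Real.exp_add, ← mul_assoc]
    calc 1 + ‖y (k + 1)‖ ≤ (1 + ‖y k‖) * ((2 * C + 1) * δ k + 1) := by linarith
      _ ≤ _ := by
        gcongr
        exact Real.add_one_le_exp _

/-- If the times stayed below `s`, the nodes would be bounded, so the steps would be bounded below
and their sum would diverge. -/
theorem exists_lt_time (h : IsEulerScheme X F x₀ ε y δ w) (hC : 0 ≤ C)
    (hF : LinearGrowthOn X F C) (hε : ε ≤ 1) (s : ℝ) :
    ∃ k, s < ∑ i ∈ Finset.range (k + 1), δ i := by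
  by_contra! hs
  have hs' : ∀ k, ∑ i ∈ Finset.range k, δ i ≤ s := fun k =>
    (h.monotone_time k.le_succ).trans (hs k)
  obtain ⟨a, ha, hδ⟩ := h.step_ge ((1 + ‖x₀‖) * Real.exp ((2 * C + 1) * s)) fun k =>
    calc ‖y k‖ ≤ 1 + ‖y k‖ := by linarith
      _ ≤ _ := h.norm_le hC hF hε k
      _ ≤ _ := by gcongr; exact hs' k
  obtain ⟨N, hN⟩ := exists_nat_gt (s / a)
  rw [div_lt_iff₀ ha] at hN
  have : (N : ℝ) * a ≤ ∑ i ∈ Finset.range N, δ i := by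
    simpa using Finset.card_nsmul_le_sum (Finset.range N) δ a fun k _ => hδ k
  linarith [hs' N]

theorem exists_sub_eq_smul (h : IsEulerScheme X F x₀ ε y δ w) {S : Set (Euc n)}
    (hS : Convex ℝ S) (hSne : S.Nonempty) {a b : ℕ} (hab : a ≤ b)
    (hw : ∀ k, a ≤ k → k < b → w k ∈ S) :
    ∃ c ∈ S, y b - y a =
      (∑ i ∈ Finset.range b, δ i - ∑ i ∈ Finset.range a, δ i) • c := by
  induction b, hab using Nat.le_induction with
  | base =>
    obtain ⟨c, hc⟩ := hSne
    exact ⟨c, hc, by simp⟩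
  | succ b hab ih =>
    obtain ⟨c, hc, hce⟩ := ih fun k hk hkb => hw k hk (hkb.trans b.lt_succ_self)
    have hδ := h.step_pos b
    have hθ : 0 ≤ ∑ i ∈ Finset.range b, δ i - ∑ i ∈ Finset.range a, δ i :=
      sub_nonneg.2 (h.monotone_time hab)
    rw [Finset.sum_range_succ, add_sub_right_comm]
    generalize ∑ i ∈ Finset.range b, δ i - ∑ i ∈ Finset.range a, δ i = θ at hce hθ ⊢
    refine ⟨(θ / (θ + δ b)) • c + (δ b / (θ + δ b)) • w b,
      hS hc (hw b hab b.lt_succ_self) (by positivity) (by positivity) (by field_simp), ?_⟩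
    rw [smul_add, smul_smul, smul_smul, mul_div_cancel₀ _ (by positivity),
      mul_div_cancel₀ _ (by positivity), h.succ_eq, add_sub_right_comm, hce]

end IsEulerScheme

/-- A (discontinuous) curve in `X` whose increments are, up to `ε`, integrals of values of the
thickened field. -/
structure IsApproxSolution (X : Set (Euc n)) (F : Euc n → Set (Euc n)) (x₀ : Euc n) (C ε : ℝ)
    (z : ℝ → Euc n) : Prop where
  init : z 0 = x₀
  mem : ∀ t, 0 ≤ t → z t ∈ X
  norm_le : ∀ t, 0 ≤ t → 1 + ‖z t‖ ≤ (1 + ‖x₀‖) * Real.exp ((2 * C + 1) * t)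
  sub_eq : ∀ s t, 0 ≤ s → s ≤ t → ∀ S : Set (Euc n), Convex ℝ S → S.Nonempty →
    (∀ r, s ≤ r → r ≤ t → thickenedField X F ε (z r) ⊆ S) →
    ∃ θ, 0 ≤ θ ∧ |θ - (t - s)| ≤ ε ∧ ∃ c ∈ S, z t - z s = θ • c

theorem exists_isApproxSolution (hX : IsClosed X) (hne : ∀ x ∈ X, (F x).Nonempty)
    (hT : ∀ x ∈ X, F x ⊆ tangentCone X x) (hC : 0 ≤ C) (hF : LinearGrowthOn X F C)
    (hx₀ : x₀ ∈ X) (hε : 0 < ε) (hε1 : ε ≤ 1) : ∃ z, IsApproxSolution X F x₀ C ε z := by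
  obtain ⟨y, δ, w, h⟩ := exists_isEulerScheme hX hne hT hε hx₀
  set τ : ℕ → ℝ := fun k => ∑ i ∈ Finset.range k, δ i with hτ
  have hτ0 : τ 0 = 0 := by simp [hτ]
  have hτs : ∀ k, τ (k + 1) = τ k + δ k := fun k => Finset.sum_range_succ _ _
  have hmono : Monotone τ := h.monotone_time
  have hκ : ∀ s : ℝ, ∃ k, 0 ≤ s → τ k ≤ s ∧ s < τ (k + 1) := fun s => by
    classical
    have hex := h.exists_lt_time hC hF hε1 s
    refine ⟨Nat.find hex, fun hs => ⟨?_, Nat.find_spec hex⟩⟩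
    rcases hk : Nat.find hex with _ | j
    · rwa [hτ0]
    · exact not_lt.1 (Nat.find_min hex (hk ▸ j.lt_succ_self))
  choose κ hκ using hκ
  have huniq : ∀ s k, 0 ≤ s → τ k ≤ s → s < τ (k + 1) → κ s = k := fun s k hs h1 h2 => by
    obtain ⟨h3, h4⟩ := hκ s hs
    rcases lt_trichotomy (κ s) k with hlt | heq | hgt
    · linarith [hmono (Nat.succ_le_of_lt hlt)]
    · exact heq
    · linarith [hmono (Nat.succ_le_of_lt hgt)]
  -- Piecewise constant rather than affine interpolation, so that the curve stays in `X`.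
  refine ⟨fun s => y (κ s), ?_, fun t _ => h.mem _, fun t ht => ?_, ?_⟩
  · have : κ 0 = 0 := huniq 0 0 le_rfl hτ0.le (by rw [hτs, hτ0]; linarith [h.step_pos 0])
    rw [this, h.init]
  · refine (h.norm_le hC hF hε1 _).trans ?_
    gcongr
    exact (hκ t ht).1
  · intro s t hs hst S hS hSne hsub
    obtain ⟨hs1, hs2⟩ := hκ s hs
    obtain ⟨ht1, ht2⟩ := hκ t (hs.trans hst)
    have hle : κ s ≤ κ t := by
      by_contra! hlt
      linarith [hmono (Nat.succ_le_of_lt hlt)]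
    obtain ⟨c, hc, hce⟩ := h.exists_sub_eq_smul hS hSne hle fun k hk hkt => by
      -- The first node may precede time `s`, but its slope is seen at `s`, where the curve has the
      -- same value; later nodes are seen at their own times.
      rcases hk.eq_or_lt with rfl | hk
      · exact hsub s le_rfl hst (h.slope_mem _)
      · have h1 : s ≤ τ k := hs2.le.trans (hmono (Nat.succ_le_of_lt hk))
        have h2 : τ k ≤ t := (hmono hkt.le).trans ht1
        have h3 : κ (τ k) = k := huniq _ _ (hs.trans h1) le_rfl
          (by rw [hτs]; linarith [h.step_pos k])
        have h4 := hsub (τ k) h1 h2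
        rw [h3] at h4
        exact h4 (h.slope_mem k)
    refine ⟨_, sub_nonneg.2 (h.monotone_time hle), ?_, c, hc, hce⟩
    rw [hτs] at hs2 ht2
    have := h.step_le (κ s)
    have := h.step_le (κ t)
    rw [abs_le]
    constructor <;> linarith

theorem IsApproxSolution.norm_sub_le {z : ℝ → Euc n} (h : IsApproxSolution X F x₀ C ε z)
    (hC : 0 ≤ C) (hF : LinearGrowthOn X F C) (hε1 : ε ≤ 1) {s t M : ℝ} (hs : 0 ≤ s) (hst : s ≤ t)
    (htM : t ≤ M) :
    ‖z t - z s‖ ≤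
      (2 * C + 1) * ((1 + ‖x₀‖) * Real.exp ((2 * C + 1) * M)) * (t - s + ε) := by
  set ρ := (2 * C + 1) * ((1 + ‖x₀‖) * Real.exp ((2 * C + 1) * M))
  have hρ : 0 ≤ ρ := by positivity
  obtain ⟨θ, hθ, hθε, c, hc, he⟩ := h.sub_eq s t hs hst (Metric.closedBall 0 ρ)
    (convex_closedBall _ _) ⟨0, by simpa using hρ⟩ fun r hsr hrt w hw => by
      rw [mem_closedBall_zero_iff]
      refine (hF.norm_le_of_mem_thickenedField hC hε1 hw).trans ?_
      refine mul_le_mul_of_nonneg_left ((h.norm_le r (hs.trans hsr)).trans ?_) (by positivity)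
      gcongr
      exact hrt.trans htM
  rw [mem_closedBall_zero_iff] at hc
  rw [he, norm_smul, Real.norm_of_nonneg hθ, mul_comm]
  have := (abs_le.1 hθε).2
  gcongr
  linarith

end Euler

/-! ### Growth and upper semicontinuity of the Krasovskii regularization. -/

section Krasovskii

variable {X : Set (Euc n)} {F : Euc n → Set (Euc n)} {x₀ : Euc n} {C ε : ℝ}

/-- The values of `F` at the points of `X` within `η` of `x`. -/
def localValues (X : Set (Euc n)) (F : Euc n → Set (Euc n)) (η : ℝ) (x : Euc n) : Set (Euc n) :=
  {v | ∃ y ∈ X, dist y x ≤ η ∧ v ∈ F y}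

theorem LinearGrowthOn.norm_le_of_mem_krasovskii (hF : LinearGrowthOn X F C) {x v : Euc n}
    (hv : v ∈ krasovskii X F x) : ‖v‖ ≤ C * (1 + ‖x‖) := by
  suffices h : krasovskii X F x ⊆ Metric.closedBall 0 (C * (1 + ‖x‖)) from
    mem_closedBall_zero_iff.1 (h hv)
  refine closedConvexHull_min ?_ (convex_closedBall _ _) Metric.isClosed_closedBall
  rintro u ⟨p, hp, hpx, φ, w, hφ, hw, hwu⟩
  rw [mem_closedBall_zero_iff]
  have h1 : Tendsto (fun j => C * (1 + ‖p (φ j)‖)) atTop (𝓝 (C * (1 + ‖x‖))) :=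
    ((hpx.comp hφ.tendsto_atTop).norm.const_add 1).const_mul C
  exact le_of_tendsto_of_tendsto' hwu.norm h1 fun j => hF _ (hp _) _ (hw j)

/-- Upper semicontinuity by compactness: values at points tending to `x` that stay away from the
hull are bounded, and a cluster point would lie in the outer limit. -/
theorem exists_localValues_subset_cthickening (hC : 0 ≤ C) (hF : LinearGrowthOn X F C)
    (x : Euc n) (hε : 0 < ε) :
    ∃ η > 0, localValues X F η x ⊆ Metric.cthickening ε (krasovskii X F x) := by
  by_contra! H
  have hpos : ∀ k : ℕ, (0 : ℝ) < 1 / ((k : ℝ) + 1) := fun k => Nat.one_div_pos_of_nat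
  choose u hu hux using fun k : ℕ => not_subset.1 (H _ (hpos k))
  choose p hp hpx hup using hu
  have hplim : Tendsto p atTop (𝓝 x) :=
    tendsto_iff_dist_tendsto_zero.2
      (squeeze_zero (fun _ => dist_nonneg) hpx tendsto_one_div_add_atTop_nhds_zero_nat)
  have hb : ∀ k, u k ∈ Metric.closedBall (0 : Euc n) (C * (2 + ‖x‖)) := fun k => by
    rw [mem_closedBall_zero_iff]
    refine (hF _ (hp k) _ (hup k)).trans (mul_le_mul_of_nonneg_left ?_ hC)
    have h1 : dist (p k) x ≤ 1 :=
      (hpx k).trans ((div_le_one (by positivity)).2 (by linarith [k.cast_nonneg (α := ℝ)]))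
    rw [dist_eq_norm] at h1
    linarith [norm_le_norm_add_norm_sub' (p k) x]
  obtain ⟨v, -, φ, hφ, hlim⟩ := (isCompact_closedBall _ _).tendsto_subseq hb
  have hv : v ∈ krasovskii X F x :=
    subset_closedConvexHull ⟨p, hp, hplim, φ, u ∘ φ, hφ, fun j => hup _, hlim⟩
  obtain ⟨j, hj⟩ := (hlim.eventually (Metric.closedBall_mem_nhds v hε)).exists
  exact hux _ (Metric.mem_cthickening_of_dist_le _ v _ _ hv hj)

theorem mem_krasovskii_of_forall (hC : 0 ≤ C) (hF : LinearGrowthOn X F C) {x v : Euc n}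
    (hv : ∀ η > 0, v ∈ closedConvexHull ℝ (localValues X F η x)) : v ∈ krasovskii X F x := by
  rw [krasovskii, ← (isClosed_closedConvexHull (𝕜 := ℝ) (s := outerLimit X F x)).closure_eq,
    Metric.closure_eq_iInter_cthickening]
  refine mem_iInter₂.2 fun ε hε => ?_
  obtain ⟨η, hη, hsub⟩ := exists_localValues_subset_cthickening hC hF x hε
  exact closedConvexHull_min hsub (convex_closedConvexHull.cthickening ε)
    Metric.isClosed_cthickening (hv η hη)

end Krasovskii

/-! ### Passage to the limit: complete solutions from any point of `X`. -/

section Existence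

variable {X : Set (Euc n)} {F : Euc n → Set (Euc n)} {x₀ : Euc n} {C : ℝ}

theorem thickenedField_subset_cthickening {ε η : ℝ} {x z : Euc n} (h : ε + dist z x ≤ η) :
    thickenedField X F ε z ⊆
      Metric.cthickening ε (closedConvexHull ℝ (localValues X F η x)) := by
  rintro w ⟨y, hy, hyz, v, hv, hwv⟩
  refine Metric.mem_cthickening_of_dist_le w v _ _ (subset_closedConvexHull ⟨y, hy, ?_, hv⟩) hwv
  linarith [dist_triangle y z x]

/-- Slopes of pointwise limits of approximate solutions are averages of nearby values of `F`. -/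
theorem slope_mem_closedConvexHull (hne : ∀ x ∈ X, (F x).Nonempty) (hC : 0 ≤ C)
    (hF : LinearGrowthOn X F C) {U : Filter ℕ} [U.NeBot] {ε : ℕ → ℝ} {z : ℕ → ℝ → Euc n}
    (hε : Tendsto ε U (𝓝 0)) (hεpos : ∀ k, 0 < ε k) (hε1 : ∀ k, ε k ≤ 1)
    (hz : ∀ k, IsApproxSolution X F x₀ C (ε k) (z k)) {s t M η : ℝ} {ys yt : Euc n}
    (ht : 0 ≤ t) (hts : t < s) (hsM : s ≤ M) (hyt : Tendsto (z · t) U (𝓝 yt))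
    (hys : Tendsto (z · s) U (𝓝 ys)) (hytX : yt ∈ X) (hη : 0 < η)
    (hsη : (2 * C + 1) * ((1 + ‖x₀‖) * Real.exp ((2 * C + 1) * M)) * (s - t) < η) :
    (s - t)⁻¹ • (ys - yt) ∈ closedConvexHull ℝ (localValues X F η yt) := by
  set ρ := (2 * C + 1) * ((1 + ‖x₀‖) * Real.exp ((2 * C + 1) * M))
  set S := closedConvexHull ℝ (localValues X F η yt) with hSdef
  have hρ : 0 ≤ ρ := by positivity
  have hSne : S.Nonempty := by
    obtain ⟨v, hv⟩ := hne yt hytX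
    exact ⟨v, subset_closedConvexHull ⟨yt, hytX, by simpa using hη.le, hv⟩⟩
  -- On `[t, s]` the `k`-th curve moves at most `ρ * (s - t + ε k)` from its value at `t`, so its
  -- thickened field only involves points within `η` of `yt`.
  have hev : ∀ᶠ k in U, ε k + (ρ * (s - t + ε k) + dist (z k t) yt) < η := by
    have h1 : Tendsto (fun k => ε k + (ρ * (s - t + ε k) + dist (z k t) yt)) U
        (𝓝 (0 + (ρ * (s - t + 0) + dist yt yt))) :=
      hε.add (((hε.const_add _).const_mul _).add (hyt.dist tendsto_const_nhds))
    refine h1.eventually (gt_mem_nhds ?_)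
    simpa using hsη
  have key : ∀ᶠ k in U, ∃ θ, |θ - (s - t)| ≤ ε k ∧
      ∃ c ∈ Metric.cthickening (ε k) S, z k s - z k t = θ • c := by
    filter_upwards [hev] with k hk
    obtain ⟨θ, -, hθ, hc⟩ := (hz k).sub_eq t s ht hts.le (Metric.cthickening (ε k) S)
      (convex_closedConvexHull.cthickening _) (hSne.mono (Metric.self_subset_cthickening _))
      fun r htr hrs => thickenedField_subset_cthickening (by
        have h1 := (hz k).norm_sub_le hC hF (hε1 k) ht htr (hrs.trans hsM)
        rw [← dist_eq_norm] at h1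
        have h2 : ρ * (r - t + ε k) ≤ ρ * (s - t + ε k) := by gcongr
        linarith [dist_triangle (z k r) (z k t) yt])
    exact ⟨θ, hθ, hc⟩
  have hst : 0 < s - t := sub_pos.2 hts
  choose! θ hθ c hc hce using fun k (hk : ∃ θ, |θ - (s - t)| ≤ ε k ∧
      ∃ c ∈ Metric.cthickening (ε k) S, z k s - z k t = θ • c) => hk
  have hθlim : Tendsto θ U (𝓝 (s - t)) := by
    rw [tendsto_iff_dist_tendsto_zero]
    refine squeeze_zero' (.of_forall fun _ => dist_nonneg) ?_ hε
    filter_upwards [key] with k hk using hθ k hk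
  have hclim : Tendsto c U (𝓝 ((s - t)⁻¹ • (ys - yt))) := by
    refine ((hθlim.inv₀ hst.ne').smul (hys.sub hyt)).congr' ?_
    filter_upwards [key, hθlim.eventually_ne hst.ne'] with k hk hk0
    rw [hce k hk, smul_smul, inv_mul_cancel₀ hk0, one_smul]
  have hinf : Metric.infDist ((s - t)⁻¹ • (ys - yt)) S ≤ 0 := by
    refine le_of_tendsto_of_tendsto
      ((Metric.continuous_infDist_pt S).continuousAt.tendsto.comp hclim) hε ?_
    filter_upwards [key] with k hk
    exact ENNReal.toReal_le_of_le_ofReal (hεpos k).le (Metric.mem_cthickening_iff.1 (hc k hk))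
  exact (isClosed_closedConvexHull.mem_iff_infDist_zero hSne).2
    (le_antisymm hinf Metric.infDist_nonneg)

/-- `F`-viability of a closed set: complete Lipschitz solutions of the Krasovskii inclusion. -/
theorem exists_complete_solution (hX : IsClosed X) (hne : ∀ x ∈ X, (F x).Nonempty)
    (hT : ∀ x ∈ X, F x ⊆ tangentCone X x) (hC : 0 ≤ C) (hF : LinearGrowthOn X F C)
    (hx₀ : x₀ ∈ X) :
    ∃ y : ℝ → Euc n, y 0 = x₀ ∧ (∀ t, 0 ≤ t → y t ∈ X) ∧
      (∀ M, ∃ K, ∀ s t, 0 ≤ s → s ≤ t → t ≤ M → dist (y s) (y t) ≤ K * (t - s)) ∧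
      ∀ t v, 0 ≤ t → HasDerivAt y v t → v ∈ krasovskii X F (y t) := by
  have hpos : ∀ k : ℕ, (0 : ℝ) < 1 / ((k : ℝ) + 1) := fun k => Nat.one_div_pos_of_nat
  have hle : ∀ k : ℕ, 1 / ((k : ℝ) + 1) ≤ 1 := fun k =>
    (div_le_one (by positivity)).2 (by linarith [k.cast_nonneg (α := ℝ)])
  choose z hz using fun k : ℕ =>
    exists_isApproxSolution hX hne hT hC hF hx₀ (hpos k) (hle k)
  -- An ultrafilter gives limits at all times at once, with no equicontinuity or diagonal
  -- extraction; the approximations are discontinuous.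
  let U : Ultrafilter ℕ := hyperfilter ℕ
  have hU : Tendsto (fun k : ℕ => 1 / ((k : ℝ) + 1)) U (𝓝 0) :=
    tendsto_one_div_add_atTop_nhds_zero_nat.mono_left Nat.hyperfilter_le_atTop
  have hlim : ∀ t, ∃ p, 0 ≤ t → Tendsto (z · t) U (𝓝 p) := fun t => by
    by_cases ht : 0 ≤ t
    · have hb : ∀ k, z k t ∈
          Metric.closedBall (0 : Euc n) ((1 + ‖x₀‖) * Real.exp ((2 * C + 1) * t)) := fun k => by
        rw [mem_closedBall_zero_iff]
        linarith [(hz k).norm_le t ht]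
      obtain ⟨p, -, hp⟩ := (isCompact_closedBall _ _).ultrafilter_le_nhds'
        (U.map (z · t)) (Ultrafilter.mem_map.2 (Filter.univ_mem' hb))
      exact ⟨p, fun _ => hp⟩
    · exact ⟨0, fun h => absurd h ht⟩
  choose y hy using hlim
  have hyX : ∀ t, 0 ≤ t → y t ∈ X := fun t ht =>
    hX.mem_of_tendsto (hy t ht) (.of_forall fun k => (hz k).mem t ht)
  refine ⟨y, ?_, hyX, fun M => ?_, fun t v ht hv => ?_⟩
  · refine tendsto_nhds_unique (hy 0 le_rfl) ?_
    simp only [(hz _).init]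
    exact tendsto_const_nhds
  · refine ⟨(2 * C + 1) * ((1 + ‖x₀‖) * Real.exp ((2 * C + 1) * M)), fun s t hs hst htM => ?_⟩
    rw [dist_comm, dist_eq_norm]
    refine le_of_tendsto_of_tendsto' ((hy t (hs.trans hst)).sub (hy s hs)).norm ?_
      fun k => (hz k).norm_sub_le hC hF (hle k) hs hst htM
    simpa using (hU.const_add (t - s)).const_mul _
  · refine mem_krasovskii_of_forall hC hF fun η hη => ?_
    have h1 : Tendsto (slope y t) (𝓝[>] t) (𝓝 v) :=
      hv.tendsto_slope.mono_left (nhdsWithin_mono _ fun s hs => ne_of_gt hs)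
    refine isClosed_closedConvexHull.mem_of_tendsto h1 ?_
    have h2 : Tendsto (fun s => (2 * C + 1) * ((1 + ‖x₀‖) *
        Real.exp ((2 * C + 1) * (t + 1))) * (s - t)) (𝓝[>] t) (𝓝 0) := by
      refine Tendsto.mono_left ?_ nhdsWithin_le_nhds
      refine Continuous.tendsto' (by fun_prop) _ _ (by simp)
    filter_upwards [h2.eventually (gt_mem_nhds hη), Ioc_mem_nhdsGT (lt_add_one t)] with s hs hst
    exact slope_mem_closedConvexHull hne hC hF hU hpos hle hz ht hst.1 hst.2 (hy t ht)
      (hy s (ht.trans hst.1.le)) (hyX t ht) hη hs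

end Existence

/-! ### Mean value and Grönwall estimates for absolutely continuous curves. -/

section AbsolutelyContinuous

theorem _root_.LipschitzWith.comp_absolutelyContinuousOnInterval {E E' : Type*}
    [PseudoMetricSpace E] [PseudoMetricSpace E'] {φ : E → E'} {K : NNReal}
    (hφ : LipschitzWith K φ) {x : ℝ → E} {a b : ℝ} (hx : AbsolutelyContinuousOnInterval x a b) :
    AbsolutelyContinuousOnInterval (fun t => φ (x t)) a b := by
  refine squeeze_zero (fun I => Finset.sum_nonneg fun i _ => dist_nonneg) (fun I => ?_)
    (by simpa using Tendsto.const_mul (K : ℝ) hx)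
  rw [Finset.mul_sum]
  exact Finset.sum_le_sum fun i _ => hφ.dist_le_mul _ _

theorem _root_.AbsolutelyContinuousOnInterval.sub_le_of_ae_hasDerivAt_le {u : ℝ → ℝ} {s t B : ℝ}
    (hu : AbsolutelyContinuousOnInterval u s t) (hst : s ≤ t)
    (hB : ∀ᵐ r : ℝ, s ≤ r → r ≤ t → ∃ d ≤ B, HasDerivAt u d r) :
    u t - u s ≤ B * (t - s) := by
  rw [← hu.integral_deriv_eq_sub]
  calc ∫ r in s..t, deriv u r ≤ ∫ _ in s..t, B := by
        refine intervalIntegral.integral_mono_ae_restrict hst hu.intervalIntegrable_deriv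
          intervalIntegrable_const ?_
        rw [EventuallyLE, ae_restrict_iff' measurableSet_Icc]
        filter_upwards [hB] with r hr hrst
        obtain ⟨d, hd, hdr⟩ := hr hrst.1 hrst.2
        rwa [hdr.deriv]
    _ = B * (t - s) := by simp [mul_comm]

theorem norm_sub_le_of_ae_hasDerivAt {x : ℝ → Euc n} {s t B : ℝ}
    (hx : AbsolutelyContinuousOnInterval x s t) (hst : s ≤ t) (hB0 : 0 ≤ B)
    (hB : ∀ᵐ r : ℝ, s ≤ r → r ≤ t → ∃ v, ‖v‖ ≤ B ∧ HasDerivAt x v r) :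
    ‖x t - x s‖ ≤ B * (t - s) := by
  -- Pairing with the increment itself reduces the vector estimate to the scalar one.
  set e := x t - x s with he
  rcases eq_or_ne e 0 with h0 | h0
  · rw [h0, norm_zero]
    exact mul_nonneg hB0 (sub_nonneg.2 hst)
  · have h1 : AbsolutelyContinuousOnInterval (fun r => inner ℝ e (x r)) s t :=
      (innerSL ℝ e).lipschitz.comp_absolutelyContinuousOnInterval hx
    have h2 := h1.sub_le_of_ae_hasDerivAt_le (B := ‖e‖ * B) hst (by
      filter_upwards [hB] with r hr hsr hrt
      obtain ⟨v, hv, hd⟩ := hr hsr hrt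
      refine ⟨inner ℝ e v, (real_inner_le_norm e v).trans (by gcongr), ?_⟩
      exact (innerSL ℝ e).hasFDerivAt.comp_hasDerivAt r hd)
    rw [← inner_sub_right, ← he, real_inner_self_eq_norm_mul_norm, mul_assoc] at h2
    exact le_of_mul_le_mul_left h2 (norm_pos_iff.2 h0)

/-- Grönwall's inequality for absolutely continuous curves whose speed grows at most linearly. -/
theorem one_add_norm_sq_le_of_ae_hasDerivAt {x : ℝ → Euc n} {t C : ℝ}
    (hx : AbsolutelyContinuousOnInterval x 0 t) (ht : 0 ≤ t) (hC : 0 ≤ C)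
    (hB : ∀ᵐ r : ℝ, 0 ≤ r → r ≤ t → ∃ v, ‖v‖ ≤ C * (1 + ‖x r‖) ∧ HasDerivAt x v r) :
    1 + ‖x t‖ ^ 2 ≤ (1 + ‖x 0‖ ^ 2) * Real.exp (4 * C * t) := by
  have hn : AbsolutelyContinuousOnInterval (fun r => ‖x r‖) 0 t :=
    lipschitzWith_one_norm.comp_absolutelyContinuousOnInterval hx
  have hc : AbsolutelyContinuousOnInterval (fun _ : ℝ => (1 : ℝ)) 0 t :=
    contDiff_const.contDiffOn.absolutelyContinuousOnInterval
  have he : AbsolutelyContinuousOnInterval (fun r : ℝ => Real.exp (-(4 * C * r))) 0 t :=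
    ContDiffOn.absolutelyContinuousOnInterval (ContDiff.contDiffOn (by fun_prop))
  have hu : AbsolutelyContinuousOnInterval
      (fun r => (1 + ‖x r‖ ^ 2) * Real.exp (-(4 * C * r))) 0 t := by
    simp only [pow_two]
    exact (hc.fun_add (hn.fun_mul hn)).fun_mul he
  have h1 := hu.sub_le_of_ae_hasDerivAt_le (B := 0) ht (by
    filter_upwards [hB] with r hr h0r hrt
    obtain ⟨v, hv, hd⟩ := hr h0r hrt
    have hdn : HasDerivAt (fun r => 1 + ‖x r‖ ^ 2) (2 * inner ℝ (x r) v) r :=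
      hd.norm_sq.const_add 1
    have hde : HasDerivAt (fun r : ℝ => Real.exp (-(4 * C * r)))
        (Real.exp (-(4 * C * r)) * -(4 * C * 1)) r :=
      ((hasDerivAt_id r).const_mul (4 * C)).neg.exp
    refine ⟨_, ?_, hdn.mul hde⟩
    have h2 : inner ℝ (x r) v ≤ ‖x r‖ * (C * (1 + ‖x r‖)) :=
      (real_inner_le_norm _ _).trans (by gcongr)
    -- The rate `4C` comes from `2a(1 + a) ≤ 4(1 + a²)`, as `2a ≤ 1 + a²`.
    have h3 : 2 * inner ℝ (x r) v ≤ (1 + ‖x r‖ ^ 2) * (4 * C) := by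
      nlinarith [mul_nonneg hC (sq_nonneg (‖x r‖ - 1)), mul_nonneg hC (sq_nonneg ‖x r‖)]
    nlinarith [mul_nonneg (sub_nonneg.2 h3) (Real.exp_pos (-(4 * C * r))).le])
  simp only [mul_zero, neg_zero, Real.exp_zero, mul_one, zero_mul, sub_nonpos, Real.exp_neg] at h1
  rwa [← div_eq_mul_inv, div_le_iff₀ (Real.exp_pos _)] at h1

end AbsolutelyContinuous

/-! ### Limit at a finite end time and concatenation. -/

section Extension

variable {X : Set (Euc n)} {F : Euc n → Set (Euc n)} {x₀ : Euc n} {C : ℝ}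

theorem IsKrasovskiiSolution.exists_lipschitz {T : ℝ} {x : ℝ → Euc n} (hC : 0 ≤ C)
    (hF : LinearGrowthOn X F C) (hx : IsKrasovskiiSolution X F x₀ T x) :
    ∃ K ≥ 0, ∀ s t, 0 ≤ s → s ≤ t → t < T → dist (x s) (x t) ≤ K * (t - s) := by
  have hd : ∀ᵐ r : ℝ, 0 ≤ r → r < T → ∃ v, ‖v‖ ≤ C * (1 + ‖x r‖) ∧ HasDerivAt x v r := by
    filter_upwards [hx.deriv_mem] with r hr h0 hrT
    obtain ⟨v, hv, hdv⟩ := hr h0 (EReal.coe_lt_coe_iff.2 hrT)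
    exact ⟨v, hF.norm_le_of_mem_krasovskii hv, hdv⟩
  set A := (1 + ‖x 0‖ ^ 2) * Real.exp (4 * C * T)
  have hA : 0 ≤ A := by positivity
  have hbound : ∀ t, 0 ≤ t → t < T → ‖x t‖ ≤ A := fun t ht htT => by
    have h1 := one_add_norm_sq_le_of_ae_hasDerivAt
      (hx.absCont t ht (EReal.coe_lt_coe_iff.2 htT)) ht hC (by
        filter_upwards [hd] with r hr h0 hrt using hr h0 (hrt.trans_lt htT))
    have h2 : (1 + ‖x 0‖ ^ 2) * Real.exp (4 * C * t) ≤ A := by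
      refine mul_le_mul_of_nonneg_left (Real.exp_le_exp.2 ?_) (by positivity)
      exact mul_le_mul_of_nonneg_left htT.le (by positivity)
    nlinarith [sq_nonneg (‖x t‖ - 1)]
  refine ⟨C * (1 + A), by positivity, fun s t hs hst htT => ?_⟩
  rw [dist_comm, dist_eq_norm]
  refine norm_sub_le_of_ae_hasDerivAt ((hx.absCont t (hs.trans hst)
    (EReal.coe_lt_coe_iff.2 htT)).mono ?_) hst (by positivity) ?_
  · rw [uIcc_of_le hst, uIcc_of_le (hs.trans hst)]
    exact Icc_subset_Icc_left hs
  · filter_upwards [hd] with r hr hsr hrt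
    obtain ⟨v, hv, hdv⟩ := hr (hs.trans hsr) (hrt.trans_lt htT)
    refine ⟨v, hv.trans (mul_le_mul_of_nonneg_left ?_ hC), hdv⟩
    linarith [hbound r (hs.trans hsr) (hrt.trans_lt htT)]

theorem absolutelyContinuousOnInterval_of_dist_le {x : ℝ → Euc n} {t K : ℝ} (ht : 0 ≤ t)
    (h : ∀ r s, 0 ≤ r → r ≤ s → s ≤ t → dist (x r) (x s) ≤ K * (s - r)) :
    AbsolutelyContinuousOnInterval x 0 t := by
  have hl : LipschitzOnWith K.toNNReal x (uIcc 0 t) := by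
    rw [uIcc_of_le ht]
    refine LipschitzOnWith.of_dist_le_mul fun r hr s hs => ?_
    have h1 : ∀ r s, 0 ≤ r → r ≤ s → s ≤ t → dist (x r) (x s) ≤ K.toNNReal * dist r s :=
      fun r s hr hrs hst => (h r s hr hrs hst).trans (by
        rw [dist_comm, Real.dist_eq, abs_of_nonneg (sub_nonneg.2 hrs)]
        exact mul_le_mul_of_nonneg_right (Real.le_coe_toNNReal K) (sub_nonneg.2 hrs))
    rcases le_total r s with hrs | hrs
    · exact h1 r s hr.1 hrs hs.2
    · rw [dist_comm, dist_comm r s]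
      exact h1 s r hs.1 hrs hr.2
  exact hl.absolutelyContinuousOnInterval

theorem ae_differentiableAt_of_dist_le {x : ℝ → Euc n}
    (h : ∀ M, ∃ K, ∀ r s, 0 ≤ r → r ≤ s → s ≤ M → dist (x r) (x s) ≤ K * (s - r)) :
    ∀ᵐ t : ℝ, 0 ≤ t → DifferentiableAt ℝ x t := by
  have h1 : ∀ N : ℕ, ∀ᵐ t : ℝ, t ∈ uIcc (0 : ℝ) N → DifferentiableAt ℝ x t := fun N => by
    obtain ⟨K, hK⟩ := h N
    exact (absolutelyContinuousOnInterval_of_dist_le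
      N.cast_nonneg hK).boundedVariationOn.ae_differentiableAt_of_mem_uIcc
  filter_upwards [ae_all_iff.2 h1] with t ht h0
  obtain ⟨N, hN⟩ := exists_nat_ge t
  exact ht N (by rw [uIcc_of_le (h0.trans hN)]; exact ⟨h0, hN⟩)

theorem IsKrasovskiiSolution.exists_extension (hX : IsClosed X) (hne : ∀ x ∈ X, (F x).Nonempty)
    (hT : ∀ x ∈ X, F x ⊆ tangentCone X x) (hC : 0 ≤ C) (hF : LinearGrowthOn X F C)
    {T : ℝ} {x : ℝ → Euc n} (hx : IsKrasovskiiSolution X F x₀ T x) :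
    ∃ y : ℝ → Euc n, IsKrasovskiiSolution X F x₀ ⊤ y ∧ ∀ t, t < T → y t = x t := by
  have hT0 : 0 < T := EReal.coe_pos.1 hx.pos
  obtain ⟨K, hK, hlip⟩ := hx.exists_lipschitz hC hF
  obtain ⟨p, hp⟩ : ∃ p, Tendsto x (𝓝[<] T) (𝓝 p) := by
    refine cauchy_map_iff_exists_tendsto.1 (Metric.cauchy_iff.2 ⟨inferInstance, fun ε hε => ?_⟩)
    -- `K + 1` instead of `K` keeps the denominator positive when `K = 0`.
    refine ⟨x '' (Ico (max 0 (T - ε / (K + 1))) T), image_mem_map (Ico_mem_nhdsLT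
      (max_lt hT0 (by linarith [(by positivity : 0 < ε / (K + 1))]))), ?_⟩
    have h1 : ∀ s t, max 0 (T - ε / (K + 1)) ≤ s → s ≤ t → t < T → dist (x s) (x t) < ε := by
      intro s t hs hst htT
      rw [max_le_iff] at hs
      have h2 : (K + 1) * (T - s) ≤ ε := by
        have : T - s ≤ ε / (K + 1) := by linarith [hs.2]
        rwa [le_div_iff₀' (by positivity)] at this
      have h3 : K * (t - s) ≤ K * (T - s) := mul_le_mul_of_nonneg_left (by linarith) hK
      linarith [hlip s t hs.1 hst htT]
    rintro _ ⟨s, hs, rfl⟩ _ ⟨t, ht, rfl⟩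
    rcases le_total s t with hst | hst
    · exact h1 s t hs.1 hst ht.2
    · rw [dist_comm]
      exact h1 t s ht.1 hst hs.2
  have hpX : p ∈ X := hX.mem_of_tendsto hp (by
    filter_upwards [Ico_mem_nhdsLT hT0] with t ht
    exact hx.mem t ht.1 (EReal.coe_lt_coe_iff.2 ht.2))
  have hpx : ∀ s, 0 ≤ s → s < T → dist (x s) p ≤ K * (T - s) := fun s hs hsT => by
    have h1 : Tendsto (fun t => dist (x s) (x t)) (𝓝[<] T) (𝓝 (dist (x s) p)) :=
      tendsto_const_nhds.dist hp
    have h2 : Tendsto (fun t => K * (t - s)) (𝓝[<] T) (𝓝 (K * (T - s))) :=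
      Tendsto.mono_left (Continuous.tendsto (by fun_prop) _) nhdsWithin_le_nhds
    refine le_of_tendsto_of_tendsto h1 h2 ?_
    filter_upwards [Ico_mem_nhdsLT hsT] with t ht using hlip s t hs ht.1 ht.2
  obtain ⟨z, hz0, hzX, hzlip, hzK⟩ := exists_complete_solution hX hne hT hC hF hpX
  let y : ℝ → Euc n := fun t => if t < T then x t else z (t - T)
  have hyx : ∀ t, t < T → y t = x t := fun t ht => if_pos ht
  have hyz : ∀ t, T ≤ t → y t = z (t - T) := fun t ht => if_neg ht.not_gt
  have hylip : ∀ M, ∃ K, ∀ r s, 0 ≤ r → r ≤ s → s ≤ M → dist (y r) (y s) ≤ K * (s - r) := by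
    intro M
    obtain ⟨L, hL⟩ := hzlip (M - T)
    refine ⟨max K L, fun r s hr hrs hsM => ?_⟩
    have hKm : ∀ a, 0 ≤ a → K * a ≤ max K L * a := fun a ha =>
      mul_le_mul_of_nonneg_right (le_max_left _ _) ha
    have hLm : ∀ a, 0 ≤ a → L * a ≤ max K L * a := fun a ha =>
      mul_le_mul_of_nonneg_right (le_max_right _ _) ha
    rcases lt_or_ge s T with hsT | hsT
    · rw [hyx s hsT, hyx r (hrs.trans_lt hsT)]
      exact (hlip r s hr hrs hsT).trans (hKm _ (by linarith))
    · rw [hyz s hsT]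
      rcases lt_or_ge r T with hrT | hrT
      · rw [hyx r hrT]
        have h1 := hL 0 (s - T) le_rfl (by linarith) (by linarith)
        rw [hz0] at h1
        have h2 := hKm (T - r) (by linarith)
        have h3 := hLm (s - T - 0) (by linarith)
        linarith [hpx r hr hrT, dist_triangle (x r) p (z (s - T))]
      · rw [hyz r hrT]
        have h1 := hL (r - T) (s - T) (by linarith) (by linarith) (by linarith)
        have h2 := hLm (s - T - (r - T)) (by linarith)
        linarith
  refine ⟨y, ⟨EReal.zero_lt_top, ?_, fun t ht _ => ?_, fun t ht _ => ?_, ?_⟩, hyx⟩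
  · rw [hyx 0 hT0, hx.init]
  · rcases lt_or_ge t T with htT | htT
    · rw [hyx t htT]
      exact hx.mem t ht (EReal.coe_lt_coe_iff.2 htT)
    · rw [hyz t htT]
      exact hzX _ (by linarith)
  · obtain ⟨L, hL⟩ := hylip t
    exact absolutelyContinuousOnInterval_of_dist_le ht hL
  · have hTne : ∀ᵐ t : ℝ, t ≠ T := by simp [ae_iff, measure_singleton]
    filter_upwards [hx.deriv_mem, ae_differentiableAt_of_dist_le hylip, hTne] with t htx htd hne'
      ht _
    rcases lt_or_gt_of_ne hne' with htT | htT
    · obtain ⟨v, hv, hd⟩ := htx ht (EReal.coe_lt_coe_iff.2 htT)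
      rw [hyx t htT]
      refine ⟨v, hv, hd.congr_of_eventuallyEq ?_⟩
      filter_upwards [Iio_mem_nhds htT] with s hs using hyx s hs
    · have hd := (htd ht).hasDerivAt
      refine ⟨_, ?_, hd⟩
      rw [hyz t htT.le]
      refine hzK (t - T) _ (by linarith) ?_
      -- The inclusion is autonomous, so translating time by `T` preserves it.
      have h1 : HasDerivAt (fun s => y (s + T)) (deriv y t) (t - T) := by
        refine HasDerivAt.comp_add_const (t - T) T ?_
        rwa [sub_add_cancel]
      refine h1.congr_of_eventuallyEq ?_
      filter_upwards [Ioi_mem_nhds (sub_pos.2 htT)] with s hs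
      rw [hyz (s + T) (by linarith [mem_Ioi.1 hs]), add_sub_cancel_right]

end Extension

end ProjDyn

theorem mainTheorem2 (n : ℕ) (X : Set (ProjDyn.Euc n))
    (f : ProjDyn.Euc n → ProjDyn.Euc n) (g : ProjDyn.Euc n → ProjDyn.BilinForms n)
    (hg : ProjDyn.IsMetricOn X g)
    (h : (IsClosed X ∧ ProjDyn.BoundedOn X f ∧ ProjDyn.WeaklyBoundedOn X g) ∨
      (IsCompact X ∧ ContinuousOn f X ∧ ContinuousOn g X) ∨
      (IsClosed X ∧ (∃ L : NNReal, LipschitzOnWith L f X) ∧ ProjDyn.WeaklyBoundedOn X g)) :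
    ∀ x₀ ∈ X, ∀ (T : EReal) (x : ℝ → ProjDyn.Euc n),
      ProjDyn.IsKrasovskiiSolution X (ProjDyn.projField X g f) x₀ T x →
      ∃ y : ℝ → ProjDyn.Euc n,
        ProjDyn.IsKrasovskiiSolution X (ProjDyn.projField X g f) x₀ ⊤ y ∧
        ∀ t : ℝ, 0 ≤ t → (t : EReal) < T → y t = x t := by
  intro x₀ _ T x hx
  obtain ⟨hX, hcomp, A, hA, hf⟩ : IsClosed X ∧ ProjDyn.UniformlyComparableOn X g ∧
      ∃ A ≥ 0, ∀ x ∈ X, ‖f x‖ ≤ A * (1 + ‖x‖) := by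
    rcases h with ⟨hX, ⟨L, -, hL⟩, hw⟩ | ⟨hX, hfc, hgc⟩ | ⟨hX, ⟨L, hL⟩, hw⟩
    · exact ⟨hX, hw.uniformlyComparableOn hg, ProjDyn.exists_linear_growth_of_bound hL⟩
    · obtain ⟨B, hB⟩ := hX.exists_bound_of_continuousOn hfc
      exact ⟨hX.isClosed, ProjDyn.uniformlyComparableOn_of_isCompact hX hgc hg,
        ProjDyn.exists_linear_growth_of_bound hB⟩
    · exact ⟨hX, hw.uniformlyComparableOn hg, ProjDyn.exists_linear_growth_of_lipschitzOnWith hL⟩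
  obtain ⟨C, hC, hF⟩ := ProjDyn.exists_linearGrowthOn_projField hg hcomp hA hf
  induction T with
  | bot => exact absurd hx.pos not_lt_bot
  | top => exact ⟨x, hx, fun _ _ _ => rfl⟩
  | coe T =>
    obtain ⟨y, hy, hyx⟩ := hx.exists_extension hX
      (fun x hx => ProjDyn.projField_nonempty hg hx) (fun x _ v hv => hv.1) hC hF
    exact ⟨y, hy, fun t _ ht => hyx t (EReal.coe_lt_coe_iff.1 ht)⟩
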